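/- Let $K\subset\mathbb R^2$ be a convex body (a non-empty compact convex set) and $\lambda>0$. Let $\mathcal P_\lambda$ be a homogeneous Poisson point process on $\mathbb R^2$ of intensity $\lambda$, regarded as a random locally finite set. For $x\in\mathcal P_\lambda$ let $\mathcal C_x=\{y\in\mathbb R^2:\|y-x\|\le\|y-x'\|\text{ for all }x'\in\mathcal P_\lambda\}$ be its Voronoi cell. For $x\in\mathbb R^2$ let $$\mathcal F_x(K)=\bigcup_{s\in K}B_{\frac12\|s-x\|}\big(\tfrac12(s+x)\big)$$ be the Voronoi flower of $K$ with respect to $x$, where $B_r(z)$ is the closed disk of radius $r$ centred at $z$, let $\mathcal A$ denote area, and let $2\mathcal F_x(K)$ denote the image of $\mathcal F_x(K)$ under the homothety with centre $x$ and ratio $2$. Let $\mathscr S_\lambda$ be the event that some cell $\mathcal C_x$, $x\in\mathcal P_\lambda$, contains $K$. Then $\mathscr S_\lambda$ is measurable with $\mathbb P(\mathscr S_\lambda)>0$; on $\mathscr S_\lambda$ the nucleus $x\in\mathcal P_\lambda$ with $K\subset\mathcal C_x$ is almost surely unique, and it is denoted by $Z_\lambda$. Moreover $0<\int_{\mathbb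 R^2}\exp(-4\lambda\mathcal A(\mathcal F_x(K)))\,dx<\infty$, and conditionally on $\mathscr S_\lambda$: 1. $Z_\lambda$ has a density proportional to $x\mapsto\exp(-4\lambda\mathcal A(\mathcal F_x(K)))$; 2. given $Z_\lambda=x$, the set of the other points $\mathcal P_\lambda\setminus\{Z_\lambda\}$ is a Poisson point process of intensity $\lambda\mathbf 1_{\mathbb R^2\setminus 2\mathcal F_x(K)}$. In particular, the conditional distribution of $\mathcal P_\lambda$ given $\mathscr S_\lambda$ is the distribution of $\{Z\}\cup\mathcal P^{(Z)}$, where $Z$ is a random point with density proportional to $x\mapsto\exp(-4\lambda\mathcal A(\mathcal F_x(K)))$ and where, given $Z=x$, $\mathcal P^{(Z)}$ is a Poisson point process of intensity $\lambda\mathbf 1_{\mathbb R^2\setminus 2\mathcal F_x(K)}$. -/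

import Mathlib

open MeasureTheory ProbabilityTheory
open scoped ENNReal

/-- The Euclidean plane. -/
abbrev Plane : Type := EuclideanSpace ℝ (Fin 2)

/-- The Voronoi cell of the point `x` with respect to the set of nuclei `χ`. -/
def voronoiCell (χ : Set Plane) (x : Plane) : Set Plane :=
  {y | ∀ x' ∈ χ, dist y x ≤ dist y x'}

/-- The Voronoi flower of `L` with respect to `x`: the union over `s ∈ L` of the closed disks
having the segment `[x, s]` as a diameter. -/
def voronoiFlower (x : Plane) (L : Set Plane) : Set Plane :=
  ⋃ s ∈ L, Metric.closedBall (midpoint ℝ s x) (dist s x / 2)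

/-- Twice the Voronoi flower with respect to `x`: its image under the homothety with centre `x`
and ratio `2`. -/
def doubledFlower (x : Plane) (L : Set Plane) : Set Plane :=
  AffineMap.homothety x (2 : ℝ) '' voronoiFlower x L

/-- The space of locally finite subsets of the plane. -/
def PointConfig : Type :=
  {χ : Set Plane // ∀ C : Set Plane, IsCompact C → (χ ∩ C).Finite}

namespace PointConfig

/-- The underlying set of points. -/
def points (χ : PointConfig) : Set Plane := χ.1

/-- The number of points of `χ` in `B`. -/
noncomputable def count (B : Set Plane) (χ : PointConfig) : ℕ∞ := (χ.points ∩ B).encard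

/-- The σ-algebra generated by the counts of points in the Borel sets of the plane. -/
noncomputable instance : MeasurableSpace PointConfig :=
  ⨆ (B : Set Plane) (_ : MeasurableSet B), MeasurableSpace.comap (count B) inferInstance

/-- The configuration `{x} ∪ χ`. -/
def add (x : Plane) (χ : PointConfig) : PointConfig :=
  ⟨{x} ∪ χ.points, fun C hC => by
    rw [Set.union_inter_distrib_right]
    exact ((Set.finite_singleton x).subset Set.inter_subset_left).union (χ.2 C hC)⟩

/-- The configuration `χ \ {x}`. -/
def remove (x : Plane) (χ : PointConfig) : PointConfig :=
  ⟨χ.points \ {x}, fun C hC =>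
    (χ.2 C hC).subset (Set.inter_subset_inter_left C Set.sdiff_subset)⟩

end PointConfig

/-- `Q` is the law of a Poisson point process on the plane with intensity measure `μ`: the number of
points in a Borel set `B` of finite `μ`-measure is Poisson distributed with parameter `μ B`, and the
numbers of points in pairwise disjoint Borel sets are independent. -/
structure IsPoissonLaw (μ : Measure Plane) (Q : Measure PointConfig) : Prop where
  isProbabilityMeasure : IsProbabilityMeasure Q
  map_count : ∀ B : Set Plane, MeasurableSet B → μ B ≠ ∞ →
    Q.map (PointConfig.count B) =
      (poissonMeasure (μ B).toNNReal).map (fun n : ℕ => (n : ℕ∞))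
  iIndepFun_count : ∀ (n : ℕ) (B : Fin n → Set Plane), (∀ i, MeasurableSet (B i)) →
    Pairwise (fun i j => Disjoint (B i) (B j)) →
    iIndepFun (fun i => PointConfig.count (B i)) Q

/-- `x` is a nucleus of `χ` whose Voronoi cell contains `K`. -/
def IsNucleusOfCellContaining (K : Set Plane) (χ : PointConfig) (x : Plane) : Prop :=
  x ∈ χ.points ∧ K ⊆ voronoiCell χ.points x

open Classical in
/-- A nucleus of `χ` whose Voronoi cell contains `K` (and the origin if there is none). -/
noncomputable def nucleus (K : Set Plane) (χ : PointConfig) : Plane :=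
  if h : ∃ x, IsNucleusOfCellContaining K χ x then h.choose else 0

/-- The weight `exp (-4 l A(F_x(K)))`, where `A` is the area. -/
noncomputable def nucleusWeight (l : ℝ) (K : Set Plane) (x : Plane) : ℝ≥0∞ :=
  ENNReal.ofReal (Real.exp (-4 * l * volume.real (voronoiFlower x K)))

/-- The measure with density proportional to the weight, normalized to have total mass one. -/
noncomputable def nucleusLaw (l : ℝ) (K : Set Plane) : Measure Plane :=
  (∫⁻ x, nucleusWeight l K x)⁻¹ • (volume.withDensity (nucleusWeight l K))

/-! Let `Q` be the law of the process. The cell of a point `x` contains `K` exactly when no point is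
strictly closer than `x` to some `s ∈ K`, that is, when the open disks centred at the points of `K`
and passing through `x` are empty. Their union is `openDoubledFlower x K`; it agrees up to a null
set with `doubledFlower x K`, whose area is four times that of the flower.

The Mecke formula `IsPoissonLaw.reducedCampbellMeasure_eq` says that the expected number of points
`x` with `(x, χ \ {x}) ∈ A` is `λ ∫ Q {χ | (x, χ) ∈ A} dx`. Add to `A` the requirement that the open
flower of `x` be empty. Almost surely at most one point is a nucleus
(`IsPoissonLaw.ae_nucleus_unique`), so the expected number is the probability that a nucleus exists
and, paired with the other points, lies in `A`. On the right, a Poisson process conditioned to avoid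
a set is its restriction to the complement (`IsPoissonLaw.measure_void_inter`), so the integrand
factors into the weight `exp (-4λ A(F_x(K)))` and the probability of a section of `A` under the
process outside the doubled flower. This is the joint law, up to normalization. Taking `A` to be
everything, `λ` times the integral of the weight is the probability that a nucleus exists; hence the
integral is finite, and this probability is positive because the weight is.

The Mecke formula itself need only be checked on rectangles `B × {no point in C}`, because void
events form a π-system generating the σ-algebra (`PointConfig.generateFrom_voidEvents`). -/

namespace PointConfig

/-! ### Counts, the counting kernel and joint measurability -/

lemma measurable_count {B : Set Plane} (hB : MeasurableSet B) : Measurable (count B) :=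
  Measurable.of_comap_le (le_iSup₂_of_le B hB le_rfl)

lemma measurable_of_measurable_count {α : Type*} [MeasurableSpace α] {f : α → PointConfig}
    (h : ∀ B, MeasurableSet B → Measurable fun a => count B (f a)) : Measurable f := by
  rw [measurable_iff_comap_le]
  change MeasurableSpace.comap f (⨆ (B : Set Plane) (_ : MeasurableSet B), _) ≤ _
  simp only [MeasurableSpace.comap_iSup, MeasurableSpace.comap_comp]
  exact iSup₂_le fun B hB => (h B hB).comap_le

lemma finite_inter_of_isBounded (χ : PointConfig) {B : Set Plane} (hB : Bornology.IsBounded B) :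
    (χ.points ∩ B).Finite :=
  (χ.2 _ hB.isCompact_closure).subset (Set.inter_subset_inter_right _ subset_closure)

lemma countable_points (χ : PointConfig) : χ.points.Countable := by
  have h : χ.points = ⋃ n : ℕ, χ.points ∩ Metric.closedBall 0 n := by
    rw [← Set.inter_iUnion, Metric.iUnion_closedBall_nat, Set.inter_univ]
  rw [h]
  exact Set.countable_iUnion fun n =>
    (χ.finite_inter_of_isBounded Metric.isBounded_closedBall).countable

lemma measurableSet_points (χ : PointConfig) : MeasurableSet χ.points :=
  χ.countable_points.measurableSet

/-- Any finite set of points is bounded, hence is already seen inside some ball. This reduces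
measurability questions to bounded sets. -/
lemma count_eq_iSup (B : Set Plane) (χ : PointConfig) :
    count B χ = ⨆ n : ℕ, count (B ∩ Metric.closedBall 0 n) χ := by
  apply le_antisymm
  · refine ENat.forall_natCast_le_iff_le.mp fun m hm => ?_
    obtain ⟨F, hF, hFm⟩ := Set.exists_subset_encard_eq hm
    have hfin : F.Finite := Set.finite_of_encard_eq_coe hFm
    obtain ⟨r, hr⟩ := hfin.isBounded.subset_closedBall 0
    obtain ⟨n, hn⟩ := exists_nat_ge r
    refine le_iSup_of_le n ?_
    rw [← hFm]
    refine Set.encard_le_encard fun y hy => ⟨(hF hy).1, (hF hy).2, ?_⟩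
    exact Metric.closedBall_subset_closedBall hn (hr hy)
  · exact iSup_le fun n => Set.encard_le_encard
      (Set.inter_subset_inter_right _ Set.inter_subset_left)

/-- The counting measure of the points of `χ`. -/
noncomputable def countingMeasure (χ : PointConfig) : Measure Plane :=
  Measure.count.restrict χ.points

lemma countingMeasure_apply (χ : PointConfig) {B : Set Plane} (hB : MeasurableSet B) :
    χ.countingMeasure B = count B χ := by
  rw [countingMeasure, Measure.restrict_apply hB,
    Measure.count_apply (hB.inter χ.measurableSet_points), count, Set.inter_comm]

/-- The kernel sending a configuration to the counting measure of its points. -/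
noncomputable def countingKernel : Kernel PointConfig Plane where
  toFun := countingMeasure
  measurable' := by
    refine Measure.measurable_of_measurable_coe _ fun B hB => ?_
    simp_rw [countingMeasure_apply _ hB]
    exact Measurable.of_discrete.comp (measurable_count hB)

lemma countingKernel_apply (χ : PointConfig) : countingKernel χ = χ.countingMeasure := rfl

lemma countingKernel_apply' (χ : PointConfig) {B : Set Plane} (hB : MeasurableSet B) :
    countingKernel χ B = count B χ :=
  χ.countingMeasure_apply hB

/-- Concentric annuli partitioning the plane. -/
def annulus (n : ℕ) : Set Plane := disjointed (fun k : ℕ => Metric.closedBall (0 : Plane) k) n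

lemma annulus_subset (n : ℕ) : annulus n ⊆ Metric.closedBall 0 n := disjointed_subset _ _

lemma measurableSet_annulus (n : ℕ) : MeasurableSet (annulus n) :=
  MeasurableSet.disjointed (fun _ => Metric.isClosed_closedBall.measurableSet) n

lemma iUnion_annulus : ⋃ n, annulus n = Set.univ := by
  unfold annulus
  rw [iUnion_disjointed, Metric.iUnion_closedBall_nat]

lemma count_annulus_ne_top (n : ℕ) (χ : PointConfig) : count (annulus n) χ ≠ ⊤ :=
  Set.encard_ne_top_iff.mpr
    (χ.finite_inter_of_isBounded (Metric.isBounded_closedBall.subset (annulus_subset n)))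

open Classical in
/-- The part of the counting kernel in the annulus of index `p.1`, on the configurations which
have exactly `p.2` points there. -/
noncomputable def countingKernelPart (p : ℕ × ℕ) : Kernel PointConfig Plane :=
  Kernel.piecewise (measurable_count (measurableSet_annulus p.1)
    (MeasurableSet.of_discrete (s := {(p.2 : ℕ∞)})))
    (countingKernel.restrict (measurableSet_annulus p.1)) 0

instance (p : ℕ × ℕ) : IsFiniteKernel (countingKernelPart p) := by
  refine ⟨⟨p.2, ENNReal.natCast_lt_top _, fun χ => ?_⟩⟩
  classical
  rw [countingKernelPart, Kernel.piecewise_apply]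
  split_ifs with h
  · rw [Kernel.restrict_apply, Measure.restrict_apply_univ,
      countingKernel_apply' _ (measurableSet_annulus _)]
    have h' : count (annulus p.1) χ = p.2 := h
    simp [h']
  · simp

/-- The number of points in an annulus is finite for each configuration but not bounded over all of
them; splitting also by that number makes every part a finite kernel. The resulting s-finiteness
gives joint measurability and composition products. -/
lemma sum_countingKernelPart : Kernel.sum countingKernelPart = countingKernel := by
  classical
  ext χ B hB
  have h1 : ∀ n : ℕ, ∑' k : ℕ, countingKernelPart (n, k) χ B
      = countingKernel χ (B ∩ annulus n) := by
    intro n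
    obtain ⟨m, hm⟩ := ENat.ne_top_iff_exists.mp (count_annulus_ne_top n χ)
    rw [tsum_eq_single m]
    · rw [countingKernelPart, Kernel.piecewise_apply, if_pos (by exact hm.symm),
        Kernel.restrict_apply, Measure.restrict_apply hB]
    · intro k hk
      rw [countingKernelPart, Kernel.piecewise_apply, if_neg]
      · simp
      · intro h
        have h' : count (annulus n) χ = k := h
        rw [← hm] at h'
        exact hk (by exact_mod_cast h'.symm)
  rw [Kernel.sum_apply' _ _ hB, ENNReal.tsum_prod']
  simp_rw [h1]
  rw [← measure_iUnion, ← Set.inter_iUnion, iUnion_annulus, Set.inter_univ]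
  · exact fun i j hij => (disjoint_disjointed _ hij).mono Set.inter_subset_right
      Set.inter_subset_right
  · exact fun n => hB.inter (measurableSet_annulus n)

instance : IsSFiniteKernel countingKernel := by
  rw [← sum_countingKernelPart]
  infer_instance

/-- Counting the points of a measurable section is jointly measurable. -/
lemma measurable_count_section {α : Type*} [MeasurableSpace α] {A : Set (α × Plane)}
    (hA : MeasurableSet A) :
    Measurable fun p : α × PointConfig => count {y | (p.1, y) ∈ A} p.2 := by
  have h : Measurable fun p : α × PointConfig => (count {y | (p.1, y) ∈ A} p.2 : ℝ≥0∞) := by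
    have h0 := Kernel.measurable_kernel_prodMk_left (κ := Kernel.prodMkLeft α countingKernel)
      (t := {q : (α × PointConfig) × Plane | (q.1.1, q.2) ∈ A})
      (by exact (by fun_prop : Measurable fun q : (α × PointConfig) × Plane => (q.1.1, q.2)) hA)
    convert h0 using 2 with p
    rw [Kernel.prodMkLeft_apply]
    exact (countingKernel_apply' _ (measurable_prodMk_left hA)).symm
  refine measurable_to_countable' fun n => ?_
  convert h (measurableSet_singleton (n : ℝ≥0∞)) using 1
  ext p
  simp

/-! ### Deleting and adding points -/

/-- The configuration `χ \ D`. -/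
def sdiff (D : Set Plane) (χ : PointConfig) : PointConfig :=
  ⟨χ.points \ D, fun C hC => (χ.2 C hC).subset (Set.inter_subset_inter_left C Set.sdiff_subset)⟩

lemma points_sdiff (D : Set Plane) (χ : PointConfig) : (sdiff D χ).points = χ.points \ D := rfl

lemma remove_eq_sdiff (x : Plane) (χ : PointConfig) : remove x χ = sdiff {x} χ := rfl

lemma points_remove (x : Plane) (χ : PointConfig) : (remove x χ).points = χ.points \ {x} := rfl

lemma points_add (x : Plane) (χ : PointConfig) : (add x χ).points = {x} ∪ χ.points := rfl

lemma ext_points {χ χ' : PointConfig} (h : χ.points = χ'.points) : χ = χ' := Subtype.ext h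

lemma count_sdiff (D B : Set Plane) (χ : PointConfig) :
    count B (sdiff D χ) = count (B \ D) χ := by
  rw [count, count, points_sdiff]
  congr 1
  ext y
  simp only [Set.mem_inter_iff, Set.mem_sdiff]
  tauto

lemma measurable_sdiff_section {α : Type*} [MeasurableSpace α] {A : Set (α × Plane)}
    (hA : MeasurableSet A) :
    Measurable fun p : α × PointConfig => sdiff {y | (p.1, y) ∈ A} p.2 := by
  refine measurable_of_measurable_count fun B hB => ?_
  simp_rw [count_sdiff]
  exact measurable_count_section (A := {q | q.2 ∈ B} \ A) ((measurable_snd hB).diff hA)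

lemma measurable_sdiff {D : Set Plane} (hD : MeasurableSet D) : Measurable (sdiff D) := by
  refine measurable_of_measurable_count fun B hB => ?_
  simp_rw [count_sdiff]
  exact measurable_count (hB.diff hD)

lemma measurableSet_diagonal_swap : MeasurableSet {q : Plane × Plane | q.2 = q.1} :=
  measurableSet_eq_fun measurable_snd measurable_fst

lemma measurable_remove : Measurable fun p : Plane × PointConfig => remove p.1 p.2 :=
  measurable_sdiff_section (A := {q | q.2 = q.1}) measurableSet_diagonal_swap

lemma measurable_add : Measurable fun p : Plane × PointConfig => add p.1 p.2 := by
  refine measurable_of_measurable_count fun B hB => ?_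
  -- The point `x` may already belong to `χ`, so the points other than `x` are counted first and `x`
  -- is then counted once.
  have h : ∀ p : Plane × PointConfig, count B (add p.1 p.2) =
      count {y | (p.1, y) ∈ {q : Plane × Plane | q.2 ∈ B ∧ ¬ q.2 = q.1}} p.2 +
        B.indicator (fun _ => 1) p.1 := by
    rintro ⟨x, χ⟩
    by_cases hx : x ∈ B
    · rw [Set.indicator_of_mem hx, count, count, points_add, 
        ← Set.encard_insert_of_notMem (a := x)]
      · congr 1
        ext y
        simp only [Set.mem_inter_iff, Set.mem_union, Set.mem_singleton_iff, Set.mem_insert_iff,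
          Set.mem_ofPred_eq]
        by_cases hy : y = x
        · simp [hy, hx]
        · simp [hy]
      · simp
    · rw [Set.indicator_of_notMem hx, add_zero, count, count, points_add]
      congr 1
      ext y
      simp only [Set.mem_inter_iff, Set.mem_union, Set.mem_singleton_iff, Set.mem_ofPred_eq]
      by_cases hy : y = x
      · simp [hy, hx]
      · simp [hy]
  simp_rw [h]
  refine Measurable.add (measurable_count_section ((measurable_snd hB).inter ?_)) ?_
  · exact measurableSet_diagonal_swap.compl
  · exact (measurable_const.indicator hB).comp measurable_fst

/-! ### Void events generate the σ-algebra -/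

/-- The points whose first `n` binary digits in `MeasurableSpace.mapNatBool` are `c`. -/
def binaryCell (n : ℕ) (c : Fin n → Bool) : Set Plane :=
  {y | ∀ i : Fin n, MeasurableSpace.mapNatBool Plane y i = c i}

lemma measurableSet_binaryCell (n : ℕ) (c : Fin n → Bool) : MeasurableSet (binaryCell n c) := by
  have h : binaryCell n c = ⋂ i : Fin n, {y | MeasurableSpace.mapNatBool Plane y i = c i} := by
    ext y; simp [binaryCell]
  rw [h]
  refine MeasurableSet.iInter fun i => ?_
  exact (measurable_pi_apply (i : ℕ)).comp (MeasurableSpace.measurable_mapNatBool Plane)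
    (measurableSet_singleton (c i))

/-- Distinct points differ in some binary digit, and finitely many pairs need only digits up to a
common index `m`, hence the first `m + 1` digits. -/
lemma exists_injOn_binaryDigits {F : Set Plane} (hF : F.Finite) :
    ∃ n : ℕ, Set.InjOn (fun y (i : Fin n) => MeasurableSpace.mapNatBool Plane y i) F := by
  have h : ∀ p : Plane × Plane, ∃ n : ℕ, p.1 ≠ p.2 →
      MeasurableSpace.mapNatBool Plane p.1 n ≠ MeasurableSpace.mapNatBool Plane p.2 n := by
    intro p
    by_cases hp : p.1 = p.2
    · exact ⟨0, fun h => absurd hp h⟩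
    · have := (MeasurableSpace.injective_mapNatBool Plane).ne hp
      obtain ⟨n, hn⟩ := Function.ne_iff.mp this
      exact ⟨n, fun _ => hn⟩
  choose g hg using h
  obtain ⟨m, hm⟩ := ((hF.prod hF).image g).bddAbove
  refine ⟨m + 1, fun x hx y hy hxy => ?_⟩
  by_contra hne
  have hgm : g (x, y) ≤ m := hm ⟨(x, y), ⟨hx, hy⟩, rfl⟩
  exact hg (x, y) hne (congrFun hxy ⟨g (x, y), by omega⟩)

lemma sum_void_binaryCell (n : ℕ) (B : Set Plane) (χ : PointConfig) :
    ∑ c : Fin n → Bool, (if count (B ∩ binaryCell n c) χ = 0 then 0 else 1 : ℕ∞) =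
      ((fun y (i : Fin n) => MeasurableSpace.mapNatBool Plane y i) '' (χ.points ∩ B)).encard := by
  classical
  rw [Set.encard_eq_coe_toFinset_card]
  have h : ((fun y (i : Fin n) => MeasurableSpace.mapNatBool Plane y i) ''
      (χ.points ∩ B)).toFinset =
      Finset.univ.filter fun c => ¬ count (B ∩ binaryCell n c) χ = 0 := by
    ext c
    simp only [Set.mem_toFinset, Finset.mem_filter, Finset.mem_univ, true_and, count,
      Set.encard_eq_zero, ← Set.nonempty_iff_ne_empty]
    constructor
    · rintro ⟨y, hy, rfl⟩
      exact ⟨y, hy.1, hy.2, fun i => rfl⟩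
    · rintro ⟨y, hy, hyB, hyc⟩
      exact ⟨y, ⟨hy, hyB⟩, funext fun i => hyc i⟩
  rw [h, Finset.card_filter]
  push_cast
  refine Finset.sum_congr rfl fun c _ => ?_
  split_ifs <;> simp_all

/-- The number of nonempty binary cells never exceeds the number of points, and equals it once the
partition separates them. Counts are thereby expressed through void events only. -/
lemma count_eq_iSup_sum_void {B : Set Plane} (hB : Bornology.IsBounded B) (χ : PointConfig) :
    count B χ = ⨆ n : ℕ, ∑ c : Fin n → Bool,
      (if count (B ∩ binaryCell n c) χ = 0 then 0 else 1 : ℕ∞) := by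
  simp_rw [sum_void_binaryCell]
  apply le_antisymm
  · obtain ⟨n, hn⟩ := exists_injOn_binaryDigits (χ.finite_inter_of_isBounded hB)
    exact le_iSup_of_le n hn.encard_image.ge
  · exact iSup_le fun n => Set.encard_image_le _ _

lemma measurable_iSup_enat {α : Type*} [MeasurableSpace α] {f : ℕ → α → ℕ∞}
    (hf : ∀ n, Measurable (f n)) : Measurable fun a => ⨆ n, f n a := by
  have hle : ∀ k : ℕ∞, MeasurableSet {a | ⨆ n, f n a ≤ k} := fun k => by
    simp only [iSup_le_iff, Set.ofPred_forall]
    exact MeasurableSet.iInter fun n => hf n (.of_discrete (s := Set.Iic k))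
  refine measurable_to_countable' fun k => ?_
  have h : (fun a => ⨆ n, f n a) ⁻¹' {k} =
      {a | ⨆ n, f n a ≤ k} \ ⋃ (j : ℕ∞) (_ : j < k), {a | ⨆ n, f n a ≤ j} := by
    ext a
    simp only [Set.mem_preimage, Set.mem_singleton_iff, Set.mem_sdiff, Set.mem_iUnion,
      Set.mem_ofPred_eq, not_exists, not_le]
    exact ⟨fun h => ⟨h.le, fun j hj => hj.trans_eq h.symm⟩,
      fun h => h.1.antisymm (not_lt.mp fun hlt => lt_irrefl _ (h.2 _ hlt))⟩
  rw [h]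
  exact (hle k).diff (MeasurableSet.iUnion fun j => MeasurableSet.iUnion fun _ => hle j)

/-- The σ-algebra on configurations is generated by the void events. -/
lemma measurable_of_measurableSet_void {α : Type*} [MeasurableSpace α] {f : α → PointConfig}
    (h : ∀ C, MeasurableSet C → Bornology.IsBounded C → MeasurableSet {a | count C (f a) = 0}) :
    Measurable f := by
  refine measurable_of_measurable_count fun B hB => ?_
  simp_rw [count_eq_iSup B]
  refine measurable_iSup_enat fun k => ?_
  have hb : Bornology.IsBounded (B ∩ Metric.closedBall 0 (k : ℝ)) :=
    Metric.isBounded_closedBall.subset Set.inter_subset_right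
  have hm : MeasurableSet (B ∩ Metric.closedBall 0 (k : ℝ)) :=
    hB.inter Metric.isClosed_closedBall.measurableSet
  simp_rw [count_eq_iSup_sum_void hb]
  refine measurable_iSup_enat fun n => Finset.measurable_sum _ fun c _ => ?_
  exact Measurable.ite (h _ (hm.inter (measurableSet_binaryCell n c))
    (hb.subset Set.inter_subset_left)) measurable_const measurable_const

/-- The events that a bounded measurable set contains no point. -/
def voidEvents : Set (Set PointConfig) :=
  {V | ∃ C, MeasurableSet C ∧ Bornology.IsBounded C ∧ V = {χ | count C χ = 0}}

lemma measurableSet_void {C : Set Plane} (hC : MeasurableSet C) :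
    MeasurableSet {χ | count C χ = 0} :=
  measurable_count hC (measurableSet_singleton 0)

lemma generateFrom_voidEvents :
    MeasurableSpace.generateFrom voidEvents = (inferInstance : MeasurableSpace PointConfig) := by
  apply le_antisymm
  · refine MeasurableSpace.generateFrom_le ?_
    rintro _ ⟨C, hC, -, rfl⟩
    exact measurableSet_void hC
  -- Measurability of the identity, from the generated σ-algebra to the original one, is the missing
  -- inclusion.
  · have h := @measurable_of_measurableSet_void PointConfig
      (MeasurableSpace.generateFrom voidEvents) id fun C hC hb =>
        MeasurableSpace.measurableSet_generateFrom ⟨C, hC, hb, rfl⟩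
    exact fun s hs => h hs

lemma count_union_eq_zero {B C : Set Plane} {χ : PointConfig} :
    count (B ∪ C) χ = 0 ↔ count B χ = 0 ∧ count C χ = 0 := by
  simp [count, Set.inter_union_distrib_left]

lemma isPiSystem_voidEvents : IsPiSystem voidEvents := by
  rintro _ ⟨B, hB, hBb, rfl⟩ _ ⟨C, hC, hCb, rfl⟩ -
  exact ⟨B ∪ C, hB.union hC, hBb.union hCb, by ext χ; exact count_union_eq_zero.symm⟩

lemma univ_mem_voidEvents : Set.univ ∈ voidEvents :=
  ⟨∅, MeasurableSet.empty, Bornology.isBounded_empty, by simp [count]⟩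

end PointConfig

/-! ### Poisson counts and restriction -/

namespace IsPoissonLaw
open PointConfig

variable {μ : Measure Plane} {Q : Measure PointConfig} (h : IsPoissonLaw μ Q)
include h

lemma measure_count_eq {B : Set Plane} (hB : MeasurableSet B) (hμ : μ B ≠ ∞) (n : ℕ) :
    Q {χ | count B χ = n} = poissonMeasure (μ B).toNNReal {n} := by
  have h1 := congrArg (fun m => m {(n : ℕ∞)}) (h.map_count B hB hμ)
  rw [Measure.map_apply (measurable_count hB) (.of_discrete),
    Measure.map_apply .of_discrete .of_discrete] at h1
  have e : (fun k : ℕ => (k : ℕ∞)) ⁻¹' {(n : ℕ∞)} = {n} := Set.ext fun k => Nat.cast_inj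
  rw [e] at h1
  exact h1

lemma measure_void {B : Set Plane} (hB : MeasurableSet B) (hμ : μ B ≠ ∞) :
    Q {χ | count B χ = 0} = ENNReal.ofReal (Real.exp (-μ.real B)) := by
  have := h.measure_count_eq hB hμ 0
  rw [poissonMeasure_singleton] at this
  simpa [measureReal_def, ENNReal.coe_toNNReal_eq_toReal] using this

lemma measure_count_eq_one {B : Set Plane} (hB : MeasurableSet B) (hμ : μ B ≠ ∞) :
    Q {χ | count B χ = 1} = μ B * ENNReal.ofReal (Real.exp (-μ.real B)) := by
  have := h.measure_count_eq hB hμ 1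
  rw [poissonMeasure_singleton] at this
  rw [← ENNReal.ofReal_toReal hμ, mul_comm, ← ENNReal.ofReal_mul (Real.exp_pos _).le]
  simpa [measureReal_def, ENNReal.coe_toNNReal_eq_toReal] using this

lemma lintegral_count {B : Set Plane} (hB : MeasurableSet B) (hμ : μ B ≠ ∞) :
    ∫⁻ χ, (count B χ : ℝ≥0∞) ∂Q = μ B := by
  have h1 : ∫⁻ χ, (count B χ : ℝ≥0∞) ∂Q = ∫⁻ n : ℕ∞, (n : ℝ≥0∞) ∂(Q.map (count B)) :=
    (lintegral_map .of_discrete (measurable_count hB)).symm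
  rw [h1, h.map_count B hB hμ, lintegral_map .of_discrete .of_discrete, poissonMeasure,
    lintegral_sum_measure]
  simp only [lintegral_smul_measure, lintegral_dirac, smul_eq_mul]
  set r := (μ B).toNNReal with hr
  -- The Poisson weights satisfy `(n + 1) p (n + 1) = r p n`, so the mean is `r` times the total
  -- mass.
  have hterm : ∀ n : ℕ, ENNReal.ofReal (Real.exp (-r) * r ^ (n + 1) / (n + 1).factorial) *
      (((n + 1 : ℕ) : ℕ∞) : ℝ≥0∞) =
      (r : ℝ≥0∞) * ENNReal.ofReal (Real.exp (-r) * r ^ n / n.factorial) := by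
    intro n
    have e1 : (((n + 1 : ℕ) : ℕ∞) : ℝ≥0∞) = ENNReal.ofReal (n + 1 : ℝ) := by
      rw [ENNReal.ofReal_add (by positivity) (by positivity)]; simp
    have e2 : (r : ℝ≥0∞) = ENNReal.ofReal (r : ℝ) := by simp
    rw [e1, e2, ← ENNReal.ofReal_mul (by positivity), ← ENNReal.ofReal_mul (by positivity)]
    congr 1
    rw [Nat.factorial_succ]
    push_cast
    field_simp
    ring
  rw [tsum_eq_zero_add' ENNReal.summable]
  simp only [hterm]
  rw [ENNReal.tsum_mul_left]
  have hs : ∑' n : ℕ, ENNReal.ofReal (Real.exp (-r) * r ^ n / n.factorial) = 1 := by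
    rw [← ENNReal.ofReal_tsum_of_nonneg (fun n => by positivity)
      (hasSum_one_poissonMeasure r).summable, (hasSum_one_poissonMeasure r).tsum_eq]
    simp
  rw [hs]
  simp [hr, ENNReal.coe_toNNReal hμ]

lemma indepFun_count {B C : Set Plane} (hB : MeasurableSet B) (hC : MeasurableSet C)
    (hBC : Disjoint B C) : IndepFun (count B) (count C) Q := by
  have := h.iIndepFun_count 2 ![B, C] (by intro i; fin_cases i <;> assumption) (by
    intro i j hij
    fin_cases i <;> fin_cases j <;> first | exact absurd rfl hij | exact hBC | exact hBC.symm)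
  exact this.indepFun (i := 0) (j := 1) (by simp)

/-- Restricting a Poisson process to `Dᶜ` gives a Poisson process. -/
lemma map_sdiff {D : Set Plane} (hD : MeasurableSet D) :
    IsPoissonLaw (μ.restrict Dᶜ) (Q.map (sdiff D)) where
  isProbabilityMeasure :=
    have := h.isProbabilityMeasure
    Measure.isProbabilityMeasure_map (measurable_sdiff hD).aemeasurable
  map_count B hB hμ := by
    rw [Measure.restrict_apply hB, ← Set.sdiff_eq] at hμ ⊢
    rw [Measure.map_map (measurable_count hB) (measurable_sdiff hD), ← h.map_count _ (hB.diff hD) hμ]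
    congr 1
    exact funext fun χ => count_sdiff D B χ
  iIndepFun_count n B hB hd := by
    have := h.isProbabilityMeasure
    have := Measure.isProbabilityMeasure_map (μ := Q) (measurable_sdiff hD).aemeasurable
    have hm : Measurable fun (χ : PointConfig) i => count (B i) χ :=
      measurable_pi_lambda _ fun i => measurable_count (hB i)
    have h1 := h.iIndepFun_count n (fun i => B i \ D) (fun i => (hB i).diff hD)
      fun i j hij => (hd hij).mono Set.sdiff_subset Set.sdiff_subset
    -- Independence is rewritten as a product law, which passes through the pushforward by `sdiff
    -- D`.
    rw [iIndepFun_iff_map_fun_eq_pi_map (fun i => (measurable_count (hB i)).aemeasurable)]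
    rw [iIndepFun_iff_map_fun_eq_pi_map
      (fun i => (measurable_count ((hB i).diff hD)).aemeasurable)] at h1
    rw [Measure.map_map hm (measurable_sdiff hD)]
    simp_rw [Measure.map_map (measurable_count (hB _)) (measurable_sdiff hD)]
    convert h1 using 2
    · ext χ i; exact count_sdiff D (B i) χ
    · ext i; congr 2; ext χ; exact count_sdiff D (B i) χ

end IsPoissonLaw

/-! ### The Mecke formula -/

namespace PointConfig

/-- The pairs of a point of `χ` and of the configuration of the other points, counted with `Q`. -/
noncomputable def reducedCampbellMeasure (Q : Measure PointConfig) :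
    Measure (Plane × PointConfig) :=
  (Q ⊗ₘ countingKernel).map fun p => (p.2, remove p.2 p.1)

lemma measurable_remove_swap :
    Measurable fun p : PointConfig × Plane => (p.2, remove p.2 p.1) :=
  measurable_snd.prodMk (measurable_remove.comp measurable_swap)

lemma reducedCampbellMeasure_apply (Q : Measure PointConfig) [SFinite Q]
    {A : Set (Plane × PointConfig)} (hA : MeasurableSet A) :
    reducedCampbellMeasure Q A =
      ∫⁻ χ, (({x ∈ χ.points | (x, remove x χ) ∈ A}.encard : ℕ∞) : ℝ≥0∞) ∂Q := by
  rw [reducedCampbellMeasure, Measure.map_apply measurable_remove_swap hA,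
    Measure.compProd_apply (measurable_remove_swap hA)]
  refine lintegral_congr fun χ => ?_
  rw [countingKernel_apply' _ (measurable_prodMk_left (measurable_remove_swap hA))]
  rfl

/-- If removing `x ∈ B` leaves `C` empty, then either `x ∉ C` and `C` was already empty, or `x` was
the only point of `C`. Each product involves counts in two disjoint sets, so independence applies to
each. -/
lemma encard_remove_void (B C : Set Plane) (χ : PointConfig) :
    (({x ∈ χ.points | x ∈ B ∧ count C (remove x χ) = 0}.encard : ℕ∞) : ℝ≥0∞) =
      (count (B \ C) χ : ℝ≥0∞) * (if count C χ = 0 then 1 else 0) +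
      (if count (B ∩ C) χ = 1 then 1 else 0) * (if count (C \ B) χ = 0 then 1 else 0) := by
  have hsplit : {x ∈ χ.points | x ∈ B ∧ count C (remove x χ) = 0} =
      {x ∈ χ.points | x ∈ B \ C ∧ count C χ = 0} ∪
      {x ∈ χ.points | x ∈ B ∩ C ∧ count (C \ {x}) χ = 0} := by
    ext x
    simp only [remove_eq_sdiff, count_sdiff, Set.mem_ofPred_eq, Set.mem_union, Set.mem_sdiff,
      Set.mem_inter_iff]
    by_cases hx : x ∈ C
    · simp [hx]
    · simp [hx, Set.sdiff_singleton_eq_self hx]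
  rw [hsplit, Set.encard_union_eq, ENat.toENNReal_add]
  · congr 1
    · split_ifs with h
      · have : {x ∈ χ.points | x ∈ B \ C ∧ count C χ = 0} = χ.points ∩ (B \ C) := by
          simp only [h, and_true]; rfl
        rw [this, mul_one]; rfl
      · simp [h]
    · by_cases h : ∃ x, {x ∈ χ.points | x ∈ B ∩ C ∧ count (C \ {x}) χ = 0} = {x}
      · obtain ⟨x, hx⟩ := h
        have hmem : x ∈ {x ∈ χ.points | x ∈ B ∩ C ∧ count (C \ {x}) χ = 0} := by rw [hx]; rfl
        obtain ⟨h1, h2, h3⟩ := hmem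
        have h3' : χ.points ∩ (C \ {x}) = ∅ := Set.encard_eq_zero.mp h3
        have hcx : ∀ y ∈ χ.points, y ∈ C → y = x := fun y hy hyC => by
          by_contra hne
          exact (h3' ▸ (⟨hy, hyC, hne⟩ : y ∈ χ.points ∩ (C \ {x})) : y ∈ (∅ : Set Plane))
        have e1 : count (B ∩ C) χ = 1 := by
          refine Set.encard_eq_one.mpr ⟨x, Set.Subset.antisymm ?_ ?_⟩
          · exact fun y hy => hcx y hy.1 hy.2.2
          · rintro _ rfl; exact ⟨h1, h2⟩
        have e2 : count (C \ B) χ = 0 := by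
          refine Set.encard_eq_zero.mpr (Set.eq_empty_of_forall_notMem fun y hy => hy.2.2 ?_)
          rw [hcx y hy.1 hy.2.1]; exact h2.1
        rw [hx, if_pos e1, if_pos e2]; simp
      · have hempty : {x ∈ χ.points | x ∈ B ∩ C ∧ count (C \ {x}) χ = 0} = ∅ := by
          by_contra hne
          obtain ⟨x, hx⟩ := Set.nonempty_iff_ne_empty.mpr hne
          refine h ⟨x, Set.Subset.antisymm (fun y hy => ?_) (by rintro _ rfl; exact hx)⟩
          by_contra hyx
          have : y ∈ χ.points ∩ (C \ {x}) := ⟨hy.1, hy.2.1.2, hyx⟩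
          rw [Set.encard_eq_zero.mp hx.2.2] at this
          exact this
        rw [hempty]
        have : ¬ (count (B ∩ C) χ = 1 ∧ count (C \ B) χ = 0) := by
          rintro ⟨e1, e2⟩
          obtain ⟨x, hx⟩ := Set.encard_eq_one.mp e1
          have hxm : x ∈ χ.points ∩ (B ∩ C) := by rw [hx]; rfl
          have : x ∈ {x ∈ χ.points | x ∈ B ∩ C ∧ count (C \ {x}) χ = 0} := by
            refine ⟨hxm.1, hxm.2, ?_⟩
            refine Set.encard_eq_zero.mpr (Set.eq_empty_of_forall_notMem fun y hy => ?_)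
            by_cases hyB : y ∈ B
            · exact hy.2.2 (hx ▸ (⟨hy.1, hyB, hy.2.1⟩ : y ∈ χ.points ∩ (B ∩ C)))
            · have : y ∈ χ.points ∩ (C \ B) := ⟨hy.1, hy.2.1, hyB⟩
              rw [Set.encard_eq_zero.mp e2] at this
              exact this
          rw [hempty] at this
          exact this
        split_ifs <;> simp_all
  · rw [Set.disjoint_left]
    exact fun x h1 h2 => h1.2.1.2 h2.2.1.2

end PointConfig

namespace IsPoissonLaw
open PointConfig

variable {μ : Measure Plane} {Q : Measure PointConfig} (h : IsPoissonLaw μ Q)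
include h

/-- By independence the two terms of `encard_remove_void` integrate to `μ(B \ C) exp(-μ C)` and `μ(B
∩ C) exp(-μ(B ∩ C)) exp(-μ(C \ B))`, whose sum is `μ B exp(-μ C)`. -/
lemma reducedCampbellMeasure_prod_void {B C : Set Plane} (hB : MeasurableSet B)
    (hC : MeasurableSet C) (hμB : μ B ≠ ∞) (hμC : μ C ≠ ∞) :
    reducedCampbellMeasure Q (B ×ˢ {χ | count C χ = 0}) = μ B * Q {χ | count C χ = 0} := by
  have := h.isProbabilityMeasure
  have hnt : ∀ {s t : Set Plane}, s ⊆ t → μ t ≠ ∞ → μ s ≠ ∞ := fun hst ht =>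
    measure_ne_top_of_subset hst ht
  have hm1 : Measurable fun n : ℕ∞ => (if n = 0 then 1 else 0 : ℝ≥0∞) := .of_discrete
  have hm2 : Measurable fun n : ℕ∞ => (if n = 1 then 1 else 0 : ℝ≥0∞) := .of_discrete
  have hm3 : Measurable fun n : ℕ∞ => (n : ℝ≥0∞) := .of_discrete
  have hvoid : ∀ {D : Set Plane}, MeasurableSet D →
      ∫⁻ χ, (if count D χ = 0 then 1 else 0 : ℝ≥0∞) ∂Q = Q {χ | count D χ = 0} := by
    intro D hD
    rw [← lintegral_indicator_one (measurableSet_void hD)]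
    exact lintegral_congr fun χ => by simp [Set.indicator_apply]
  have hone : ∀ {D : Set Plane}, MeasurableSet D →
      ∫⁻ χ, (if count D χ = 1 then 1 else 0 : ℝ≥0∞) ∂Q = Q {χ | count D χ = 1} := by
    intro D hD
    rw [← lintegral_indicator_one (s := {χ | count D χ = 1})
      (measurable_count hD (measurableSet_singleton 1))]
    exact lintegral_congr fun χ => by simp [Set.indicator_apply]
  rw [reducedCampbellMeasure_apply _ (hB.prod (measurableSet_void hC))]
  have e : ∀ χ : PointConfig, {x ∈ χ.points | (x, remove x χ) ∈ B ×ˢ {χ | count C χ = 0}} =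
      {x ∈ χ.points | x ∈ B ∧ count C (remove x χ) = 0} := fun χ => rfl
  simp_rw [e, encard_remove_void]
  have hBC := hB.diff hC
  have hIC := hB.inter hC
  have hCB := hC.diff hB
  have hm : Measurable fun χ => (count (B \ C) χ : ℝ≥0∞) * (if count C χ = 0 then 1 else 0) :=
    (hm3.comp (measurable_count hBC)).mul (hm1.comp (measurable_count hC))
  rw [lintegral_add_left hm]
  have i1 := lintegral_mul_eq_lintegral_mul_lintegral_of_indepFun
    (hm3.comp (measurable_count hBC)) (hm1.comp (measurable_count hC))
    ((h.indepFun_count hBC hC Set.disjoint_sdiff_left).comp hm3 hm1)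
  have i2 := lintegral_mul_eq_lintegral_mul_lintegral_of_indepFun
    (hm2.comp (measurable_count hIC)) (hm1.comp (measurable_count hCB))
    ((h.indepFun_count hIC hCB
      (Set.disjoint_sdiff_right.mono_left Set.inter_subset_left)).comp hm2 hm1)
  simp only [Pi.mul_apply, Function.comp_apply] at i1 i2
  rw [i1, i2, h.lintegral_count hBC (hnt Set.sdiff_subset hμB), hvoid hC, hvoid hCB, hone hIC,
    h.measure_count_eq_one hIC (hnt Set.inter_subset_right hμC), h.measure_void hC hμC,
    h.measure_void hCB (hnt Set.sdiff_subset hμC), mul_assoc (μ (B ∩ C)),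
    ← ENNReal.ofReal_mul (Real.exp_pos _).le, ← Real.exp_add]
  have hreal : -μ.real (B ∩ C) + -μ.real (C \ B) = -μ.real C := by
    rw [← measureReal_inter_add_sdiff (s := C) hB hμC, Set.inter_comm]; ring
  rw [hreal, ← add_mul, add_comm, measure_inter_add_sdiff B hC]

/-- The Mecke formula. -/
lemma reducedCampbellMeasure_eq (hμ : ∀ B, Bornology.IsBounded B → μ B ≠ ∞) :
    reducedCampbellMeasure Q = μ.prod Q := by
  have := h.isProbabilityMeasure
  have hsp : ⋃ n : ℕ, Metric.closedBall (0 : Plane) n = Set.univ := Metric.iUnion_closedBall_nat 0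
  have hcb : ∀ n : ℕ, Metric.closedBall (0 : Plane) n ∈
      {B : Set Plane | MeasurableSet B ∧ Bornology.IsBounded B} := fun n =>
    ⟨Metric.isClosed_closedBall.measurableSet, Metric.isBounded_closedBall⟩
  -- A product measure is determined by its values on rectangles from two generating π-systems; here
  -- these are the bounded Borel sets and the void events.
  refine (Measure.prod_eq_generateFrom (C := {B | MeasurableSet B ∧ Bornology.IsBounded B})
    (D := voidEvents) ?_ generateFrom_voidEvents ?_ isPiSystem_voidEvents
    ⟨fun n => Metric.closedBall 0 n, hcb, fun n => (hμ _ (hcb n).2).lt_top, hsp⟩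
    ⟨fun _ => Set.univ, fun _ => univ_mem_voidEvents, fun _ => measure_lt_top _ _,
      Set.iUnion_const _⟩
    ?_).symm
  · apply le_antisymm
    · exact MeasurableSpace.generateFrom_le fun B hB => hB.1
    · intro B hB
      rw [← Set.inter_univ B, ← hsp, Set.inter_iUnion]
      exact MeasurableSet.iUnion fun n => MeasurableSpace.measurableSet_generateFrom
        ⟨hB.inter (hcb n).1, (hcb n).2.subset Set.inter_subset_right⟩
  · exact fun B hB C hC _ => ⟨hB.1.inter hC.1, hB.2.subset Set.inter_subset_left⟩
  · rintro B ⟨hB, hBb⟩ _ ⟨C, hC, hCb, rfl⟩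
    exact h.reducedCampbellMeasure_prod_void hB hC (hμ B hBb) (hμ C hCb)

/-! ### Conditioning on a void event -/

/-- A Poisson process conditioned to avoid `D` is distributed as its restriction to `Dᶜ`. -/
lemma measure_void_inter (hμ : ∀ B, Bornology.IsBounded B → μ B ≠ ∞) {D : Set Plane}
    (hD : MeasurableSet D) (hDb : Bornology.IsBounded D) {A : Set PointConfig}
    (hA : MeasurableSet A) :
    Q ({χ | count D χ = 0} ∩ A) = Q {χ | count D χ = 0} * Q (PointConfig.sdiff D ⁻¹' A) := by
  have := h.isProbabilityMeasure
  have key : Q.restrict {χ | count D χ = 0} =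
      Q {χ | count D χ = 0} • Q.map (PointConfig.sdiff D) := by
    -- On the event that `C` is void, both sides equal `exp(-μ(D ∪ C))`, since `μ(D ∪ C) = μ D + μ(C
    -- \ D)`.
    refine ext_of_generate_finite voidEvents generateFrom_voidEvents.symm isPiSystem_voidEvents
      ?_ ?_
    · rintro _ ⟨C, hC, hCb, rfl⟩
      rw [Measure.restrict_apply (measurableSet_void hC), Measure.smul_apply,
        Measure.map_apply (measurable_sdiff hD) (measurableSet_void hC), smul_eq_mul]
      have e1 : {χ | count C χ = 0} ∩ {χ | count D χ = 0} = {χ | count (D ∪ C) χ = 0} := by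
        ext χ; rw [Set.inter_comm]; exact count_union_eq_zero.symm
      have e2 : PointConfig.sdiff D ⁻¹' {χ | count C χ = 0} = {χ | count (C \ D) χ = 0} := by
        ext χ; simp [count_sdiff]
      rw [e1, e2, h.measure_void (hD.union hC) (hμ _ (hDb.union hCb)),
        h.measure_void hD (hμ _ hDb),
        h.measure_void (hC.diff hD) (hμ _ (hCb.subset Set.sdiff_subset)),
        ← ENNReal.ofReal_mul (Real.exp_pos _).le, ← Real.exp_add, ← neg_add,
        ← Set.union_sdiff_self, measureReal_union Set.disjoint_sdiff_right (hC.diff hD)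
          (hμ _ hDb) (hμ _ (hCb.subset Set.sdiff_subset))]
    · have := Measure.isProbabilityMeasure_map (μ := Q) (measurable_sdiff hD).aemeasurable
      simp
  have := congrArg (fun m : Measure PointConfig => m A) key
  simp only [Measure.restrict_apply hA, Measure.smul_apply,
    Measure.map_apply (measurable_sdiff hD) hA, smul_eq_mul] at this
  rw [Set.inter_comm, this]

end IsPoissonLaw

/-! ### Geometry of the doubled flower -/

/-- Doubling from `x` turns the disk with diameter `[x, s]` into the disk centred at `s` with `x` on
its boundary. -/
lemma mem_doubledFlower {x y : Plane} {L : Set Plane} :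
    y ∈ doubledFlower x L ↔ ∃ s ∈ L, dist y s ≤ dist x s := by
  have key : ∀ z s : Plane, z ∈ Metric.closedBall (midpoint ℝ s x) (dist s x / 2) ↔
      dist (AffineMap.homothety x (2 : ℝ) z) s ≤ dist x s := by
    intro z s
    have e : AffineMap.homothety x (2 : ℝ) z - s = (2 : ℝ) • (z - midpoint ℝ s x) := by
      rw [AffineMap.homothety_apply, midpoint_eq_smul_add]
      simp only [vsub_eq_sub, vadd_eq_add, invOf_eq_inv]
      module
    rw [Metric.mem_closedBall, dist_eq_norm (AffineMap.homothety x (2 : ℝ) z), e, norm_smul,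
      ← dist_eq_norm, dist_comm x s, Real.norm_ofNat, le_div_iff₀ two_pos, mul_comm]
  simp only [doubledFlower, voronoiFlower, Set.mem_image, Set.mem_iUnion, exists_prop]
  constructor
  · rintro ⟨z, ⟨s, hs, hz⟩, rfl⟩
    exact ⟨s, hs, (key z s).mp hz⟩
  · rintro ⟨s, hs, h⟩
    have hy : AffineMap.homothety x (2 : ℝ) (midpoint ℝ x y) = y := by
      rw [AffineMap.homothety_apply, midpoint_eq_smul_add]
      simp only [vsub_eq_sub, vadd_eq_add, invOf_eq_inv]
      module
    exact ⟨midpoint ℝ x y, ⟨s, hs, (key _ s).mpr (by rwa [hy])⟩, hy⟩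

/-- The union of the open disks centred at the points of `L` with `x` on their boundary. -/
def openDoubledFlower (x : Plane) (L : Set Plane) : Set Plane :=
  {y | ∃ s ∈ L, dist y s < dist x s}

lemma openDoubledFlower_subset (x : Plane) (L : Set Plane) :
    openDoubledFlower x L ⊆ doubledFlower x L :=
  fun _ ⟨s, hs, h⟩ => mem_doubledFlower.mpr ⟨s, hs, h.le⟩

/-- Voronoi cells allow ties, so the only obstruction is a point strictly closer to some `s ∈ L`;
this is why the open flower appears. -/
lemma isNucleusOfCellContaining_iff {L : Set Plane} {χ : PointConfig} {x : Plane} :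
    IsNucleusOfCellContaining L χ x ↔
      x ∈ χ.points ∧ PointConfig.count (openDoubledFlower x L) χ = 0 := by
  rw [IsNucleusOfCellContaining, PointConfig.count, Set.encard_eq_zero,
    Set.eq_empty_iff_forall_notMem]
  refine and_congr_right fun _ => ⟨fun h y hy => ?_, fun h s hs y hy => ?_⟩
  · obtain ⟨s, hs, hlt⟩ := hy.2
    have := h hs y hy.1
    rw [dist_comm s, dist_comm s] at this
    exact absurd hlt this.not_gt
  · by_contra hlt
    rw [not_le, dist_comm s, dist_comm s] at hlt
    exact h y ⟨hy, s, hs, hlt⟩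

lemma isOpen_openDoubledFlower_graph (L : Set Plane) :
    IsOpen {q : Plane × Plane | q.2 ∈ openDoubledFlower q.1 L} := by
  have : {q : Plane × Plane | q.2 ∈ openDoubledFlower q.1 L} =
      ⋃ s ∈ L, {q : Plane × Plane | dist q.2 s < dist q.1 s} := by
    ext q; simp [openDoubledFlower]
  rw [this]
  exact isOpen_biUnion fun s _ => isOpen_lt (by fun_prop) (by fun_prop)

lemma measurableSet_openDoubledFlower (x : Plane) (L : Set Plane) :
    MeasurableSet (openDoubledFlower x L) :=
  measurable_prodMk_left (isOpen_openDoubledFlower_graph L).measurableSet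

/-- The graph is the projection along the compact factor `L` of a closed set, and such projections
are closed maps. -/
lemma isClosed_doubledFlower_graph {L : Set Plane} (hL : IsCompact L) :
    IsClosed {q : Plane × Plane | q.2 ∈ doubledFlower q.1 L} := by
  have := isCompact_iff_compactSpace.mp hL
  have hc : IsClosed {p : L × (Plane × Plane) | dist p.2.2 p.1 ≤ dist p.2.1 p.1} :=
    isClosed_le (by fun_prop) (by fun_prop)
  convert isClosedMap_snd_of_compactSpace _ hc using 1
  ext q
  simp [mem_doubledFlower]

lemma measurableSet_doubledFlower (x : Plane) {L : Set Plane} (hL : IsCompact L) :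
    MeasurableSet (doubledFlower x L) :=
  measurable_prodMk_left (isClosed_doubledFlower_graph hL).measurableSet

lemma isBounded_doubledFlower (x : Plane) {L : Set Plane} (hL : IsCompact L) :
    Bornology.IsBounded (doubledFlower x L) := by
  obtain ⟨r, hr⟩ := hL.isBounded.subset_closedBall x
  refine (Metric.isBounded_closedBall (x := x) (r := 2 * r)).subset fun y hy => ?_
  obtain ⟨s, hs, h⟩ := mem_doubledFlower.mp hy
  have h1 : dist s x ≤ r := hr hs
  have h2 := dist_triangle y s x
  rw [dist_comm x s] at h
  rw [Metric.mem_closedBall]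
  linarith

lemma volume_doubledFlower (x : Plane) (L : Set Plane) :
    volume (doubledFlower x L) = 4 * volume (voronoiFlower x L) := by
  rw [doubledFlower, Measure.addHaar_image_homothety]
  simp only [finrank_euclideanSpace, Fintype.card_fin]
  norm_num

/-- By strict convexity of the Euclidean norm, a point `y ≠ x` of a closed disk through `x` moves
into the interior when contracted towards `x`. -/
lemma homothety_doubledFlower_subset (x : Plane) (L : Set Plane) {t : ℝ} (h0 : 0 < t)
    (h1 : t < 1) :
    AffineMap.homothety x t '' doubledFlower x L ⊆ openDoubledFlower x L ∪ {x} := by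
  rintro _ ⟨y, hy, rfl⟩
  obtain ⟨s, hs, h⟩ := mem_doubledFlower.mp hy
  by_cases hyx : y = x
  · right; simp [hyx]
  · left
    refine ⟨s, hs, ?_⟩
    rw [dist_eq_norm] at h ⊢
    have e : AffineMap.homothety x t y - s = t • (y - s) + (1 - t) • (x - s) := by
      rw [AffineMap.homothety_apply]
      simp only [vsub_eq_sub, vadd_eq_add]
      module
    rw [e]
    exact norm_combo_lt_of_ne h (dist_eq_norm x s).ge (fun hh => hyx (sub_left_injective hh)) h0
      (by linarith) (by ring)

/-- Contracting the closed flower by `t < 1` multiplies its area by `t ^ 2` and puts it, up to the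
point `x`, inside the open one; then `t → 1`. -/
lemma volume_openDoubledFlower (x : Plane) (L : Set Plane) :
    volume (openDoubledFlower x L) = volume (doubledFlower x L) := by
  refine (measure_mono (openDoubledFlower_subset x L)).antisymm ?_
  have hle : ∀ t : ℝ, 0 < t → t < 1 →
      ENNReal.ofReal (t ^ 2) * volume (doubledFlower x L) ≤ volume (openDoubledFlower x L) := by
    intro t h0 h1
    have h := measure_mono (μ := volume) (homothety_doubledFlower_subset x L h0 h1)
    rw [Measure.addHaar_image_homothety] at h
    simp only [finrank_euclideanSpace, Fintype.card_fin, abs_of_nonneg (sq_nonneg t)] at h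
    refine h.trans ((measure_union_le _ _).trans ?_)
    simp
  have hlim : Filter.Tendsto (fun t : ℝ => ENNReal.ofReal (t ^ 2) * volume (doubledFlower x L))
      (nhdsWithin 1 (Set.Iio 1)) (nhds (1 * volume (doubledFlower x L))) := by
    refine ENNReal.Tendsto.mul_const ?_ (.inl one_ne_zero)
    have : Filter.Tendsto (fun t : ℝ => ENNReal.ofReal (t ^ 2)) (nhds 1)
        (nhds (ENNReal.ofReal (1 ^ 2))) :=
      ENNReal.tendsto_ofReal ((continuous_pow 2).tendsto 1)
    simpa using this.mono_left nhdsWithin_le_nhds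
  rw [one_mul] at hlim
  refine le_of_tendsto hlim ?_
  filter_upwards [Ioo_mem_nhdsLT (zero_lt_one' ℝ)] with t ht
  exact hle t ht.1 ht.2

lemma volume_doubledFlower_sdiff (x : Plane) {L : Set Plane} (hL : IsCompact L) :
    volume (doubledFlower x L \ openDoubledFlower x L) = 0 := by
  rw [measure_sdiff (openDoubledFlower_subset x L)
    (measurableSet_openDoubledFlower x L).nullMeasurableSet, volume_openDoubledFlower, tsub_self]
  exact measure_ne_top_of_subset (openDoubledFlower_subset x L)
    (isBounded_doubledFlower x hL).measure_lt_top.ne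

lemma nucleusWeight_eq {l : ℝ} (hl : 0 < l) (L : Set Plane) (x : Plane) :
    nucleusWeight l L x =
      ENNReal.ofReal (Real.exp (-(ENNReal.ofReal l • volume : Measure Plane).real
        (doubledFlower x L))) := by
  rw [nucleusWeight, measureReal_def, measureReal_def, Measure.smul_apply, volume_doubledFlower]
  simp only [smul_eq_mul, ENNReal.toReal_mul, ENNReal.toReal_ofReal hl.le, ENNReal.toReal_ofNat]
  congr 2
  ring

lemma measurable_nucleusWeight (l : ℝ) {L : Set Plane} (hL : IsCompact L) :
    Measurable (nucleusWeight l L) := by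
  have h : ∀ x, nucleusWeight l L x =
      ENNReal.ofReal (Real.exp (-l * (volume (doubledFlower x L)).toReal)) := by
    intro x
    rw [nucleusWeight, measureReal_def, volume_doubledFlower, ENNReal.toReal_mul]
    simp only [ENNReal.toReal_ofNat]
    congr 2
    ring
  have hm : Measurable fun x => volume (doubledFlower x L) :=
    measurable_measure_prodMk_left (isClosed_doubledFlower_graph hL).measurableSet
  simp_rw [funext h]
  fun_prop

lemma lintegral_nucleusWeight_ne_zero (l : ℝ) {L : Set Plane} (hL : IsCompact L) :
    ∫⁻ x, nucleusWeight l L x ≠ 0 := by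
  rw [Ne, lintegral_eq_zero_iff (measurable_nucleusWeight l hL)]
  intro h0
  obtain ⟨x, hx⟩ := h0.exists
  exact (ENNReal.ofReal_pos.mpr (Real.exp_pos _)).ne' hx

/-! ### Nuclei as points counted with the remaining configuration -/

namespace PointConfig

/-- The number of points of `χ` which together with the configuration of the others lie in `A`. -/
noncomputable def countWithRest (A : Set (Plane × PointConfig)) (χ : PointConfig) : ℕ∞ :=
  {x ∈ χ.points | (x, remove x χ) ∈ A}.encard

lemma measurable_countWithRest {A : Set (Plane × PointConfig)} (hA : MeasurableSet A) :
    Measurable (countWithRest A) :=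
  (measurable_count_section (measurable_remove_swap hA)).comp (measurable_id.prodMk measurable_id)

/-- The pairs of a point `x` and a configuration `χ` such that `x` is a nucleus of `{x} ∪ χ` whose
cell contains `L`. -/
def nucleusPairs (L : Set Plane) : Set (Plane × PointConfig) :=
  {p | count (openDoubledFlower p.1 L) p.2 = 0}

lemma measurableSet_nucleusPairs (L : Set Plane) : MeasurableSet (nucleusPairs L) :=
  measurable_count_section (isOpen_openDoubledFlower_graph L).measurableSet
    (measurableSet_singleton 0)

/-- A point never lies in its own open flower, so removing it does not affect the void condition. -/
lemma isNucleus_iff_mem_nucleusPairs {L : Set Plane} {χ : PointConfig} {x : Plane} :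
    IsNucleusOfCellContaining L χ x ↔ x ∈ χ.points ∧ (x, remove x χ) ∈ nucleusPairs L := by
  have hx : x ∉ openDoubledFlower x L := fun ⟨s, _, h⟩ => lt_irrefl _ h
  rw [isNucleusOfCellContaining_iff, nucleusPairs, Set.mem_ofPred_eq, remove_eq_sdiff,
    count_sdiff, Set.sdiff_singleton_eq_self hx]

/-- The uncountable existential over `x` becomes the condition that a measurable count is nonzero.
-/
lemma measurableSet_exists_nucleus (L : Set Plane) :
    MeasurableSet {χ : PointConfig | ∃ x, IsNucleusOfCellContaining L χ x} := by
  have h : {χ : PointConfig | ∃ x, IsNucleusOfCellContaining L χ x} =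
      countWithRest (nucleusPairs L) ⁻¹' {0}ᶜ := by
    ext χ
    simp only [isNucleus_iff_mem_nucleusPairs, countWithRest, Set.mem_ofPred_eq,
      Set.mem_preimage, Set.mem_compl_iff, Set.mem_singleton_iff, Set.encard_eq_zero,
      ← Set.nonempty_iff_ne_empty]
    rfl
  rw [h]
  exact measurable_countWithRest (measurableSet_nucleusPairs L) .of_discrete

lemma isNucleus_nucleus {L : Set Plane} {χ : PointConfig}
    (h : ∃ x, IsNucleusOfCellContaining L χ x) :
    IsNucleusOfCellContaining L χ (nucleus L χ) := by
  rw [nucleus, dif_pos h]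
  exact h.choose_spec

/-- Uniqueness turns the count in the Mecke formula into an indicator, and hence its expectation
into a probability. It also removes the dependence on the choice made in `nucleus`. -/
lemma countWithRest_of_unique {L : Set Plane} {χ : PointConfig}
    (hu : ∀ x x', IsNucleusOfCellContaining L χ x → IsNucleusOfCellContaining L χ x' → x = x')
    (A : Set (Plane × PointConfig)) [Decidable ((∃ x, IsNucleusOfCellContaining L χ x) ∧
      (nucleus L χ, remove (nucleus L χ) χ) ∈ A)] :
    countWithRest (nucleusPairs L ∩ A) χ =
      if (∃ x, IsNucleusOfCellContaining L χ x) ∧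
        (nucleus L χ, remove (nucleus L χ) χ) ∈ A then 1 else 0 := by
  have hset : {x ∈ χ.points | (x, remove x χ) ∈ nucleusPairs L ∩ A} =
      {x | IsNucleusOfCellContaining L χ x ∧ (x, remove x χ) ∈ A} := by
    ext x
    simp only [isNucleus_iff_mem_nucleusPairs, Set.mem_ofPred_eq, Set.mem_inter_iff, and_assoc]
  rw [countWithRest, hset]
  split_ifs with h
  · refine Set.encard_eq_one.mpr ⟨nucleus L χ, Set.Subset.antisymm ?_ ?_⟩
    · exact fun x hx => hu _ _ hx.1 (isNucleus_nucleus h.1)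
    · rintro _ rfl
      exact ⟨isNucleus_nucleus h.1, h.2⟩
  · refine Set.encard_eq_zero.mpr (Set.eq_empty_of_forall_notMem fun x hx => h ?_)
    have hn : x = nucleus L χ := hu _ _ hx.1 (isNucleus_nucleus ⟨x, hx.1⟩)
    exact ⟨⟨x, hx.1⟩, hn ▸ hx.2⟩

/-- The law of the restriction to the complement of the doubled flower with respect to `x`. -/
noncomputable def outsideFlowerKernel (Q : Measure PointConfig) [SFinite Q] {L : Set Plane}
    (hL : IsCompact L) : Kernel Plane PointConfig where
  toFun x := Q.map (sdiff (doubledFlower x L))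
  measurable' := by
    refine Measure.measurable_of_measurable_coe _ fun A hA => ?_
    simp_rw [Measure.map_apply (measurable_sdiff (measurableSet_doubledFlower _ hL)) hA]
    exact measurable_measure_prodMk_left
      (measurable_sdiff_section (isClosed_doubledFlower_graph hL).measurableSet hA)

lemma outsideFlowerKernel_apply (Q : Measure PointConfig) [SFinite Q] {L : Set Plane}
    (hL : IsCompact L) (x : Plane) :
    outsideFlowerKernel Q hL x = Q.map (sdiff (doubledFlower x L)) := rfl

instance (Q : Measure PointConfig) [IsProbabilityMeasure Q] {L : Set Plane} (hL : IsCompact L) :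
    IsMarkovKernel (outsideFlowerKernel Q hL) :=
  ⟨fun x => Measure.isProbabilityMeasure_map
    (measurable_sdiff (measurableSet_doubledFlower x hL)).aemeasurable⟩

end PointConfig

/-! ### Uniqueness and joint law of the nucleus -/

namespace IsPoissonLaw
open PointConfig

section
variable {μ : Measure Plane} {Q : Measure PointConfig} (h : IsPoissonLaw μ Q)
include h

lemma measure_count_ne_zero {B : Set Plane} (hB : MeasurableSet B) (hμ : μ B = 0) :
    Q {χ | ¬ count B χ = 0} = 0 := by
  have := h.isProbabilityMeasure
  have hv := h.measure_void hB (by simp [hμ])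
  rw [measureReal_def, hμ] at hv
  simp only [ENNReal.toReal_zero, neg_zero, Real.exp_zero, ENNReal.ofReal_one] at hv
  exact (prob_compl_eq_zero_iff (measurableSet_void hB)).mpr hv

/-- Almost surely no two points are at the same distance from `s`. -/
lemma ae_injOn_dist (hμ : ∀ B, Bornology.IsBounded B → μ B ≠ ∞)
    (hs : ∀ (s : Plane) r, μ (Metric.sphere s r) = 0) (s : Plane) :
    ∀ᵐ χ ∂Q, Set.InjOn (fun x => dist x s) χ.points := by
  have := h.isProbabilityMeasure
  set A : Set (Plane × PointConfig) :=
    {p | ¬ count {y | dist y s = dist p.1 s} p.2 = 0}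
  have hA : MeasurableSet A := by
    refine (measurable_count_section (A := {q : Plane × Plane | dist q.2 s = dist q.1 s})
      (measurableSet_eq_fun (by fun_prop) (by fun_prop)) (measurableSet_singleton 0)).compl
  -- By the Mecke formula this is an integral over `x` of the probability of a point on the sphere
  -- centred at `s` through `x`, and spheres are null.
  have h0 : reducedCampbellMeasure Q A = 0 := by
    rw [h.reducedCampbellMeasure_eq hμ, Measure.prod_apply hA, lintegral_eq_zero_iff
      (measurable_measure_prodMk_left hA)]
    refine .of_forall fun x => ?_
    exact h.measure_count_ne_zero Metric.isClosed_sphere.measurableSet (hs s (dist x s))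
  rw [reducedCampbellMeasure_apply Q hA] at h0
  have hm : Measurable fun χ => (countWithRest A χ : ℝ≥0∞) :=
    Measurable.of_discrete.comp (measurable_countWithRest hA)
  replace h0 := (lintegral_eq_zero_iff hm).mp h0
  filter_upwards [h0] with χ hχ x hx y hy hxy
  by_contra hne
  have hempty : {x ∈ χ.points | (x, remove x χ) ∈ A} = ∅ := by
    rw [← Set.encard_eq_zero]; simpa [countWithRest] using hχ
  have hmem : x ∈ {x ∈ χ.points | (x, remove x χ) ∈ A} := by
    refine ⟨hx, fun hc => ?_⟩
    have : y ∈ (remove x χ).points ∩ {y | dist y s = dist x s} :=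
      ⟨⟨hy, fun hyx => hne hyx.symm⟩, hxy.symm⟩
    rw [Set.encard_eq_zero.mp hc] at this
    exact this
  rw [hempty] at hmem
  exact hmem

/-- If two cells both contain `L`, their nuclei are equidistant from any fixed `s ∈ L`. -/
lemma ae_nucleus_unique (hμ : ∀ B, Bornology.IsBounded B → μ B ≠ ∞)
    (hs : ∀ (s : Plane) r, μ (Metric.sphere s r) = 0) {L : Set Plane} (hL : L.Nonempty) :
    ∀ᵐ χ ∂Q, ∀ x x', IsNucleusOfCellContaining L χ x → IsNucleusOfCellContaining L χ x' →
      x = x' := by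
  obtain ⟨s, hsL⟩ := hL
  filter_upwards [h.ae_injOn_dist hμ hs s] with χ hχ x x' hx hx'
  refine hχ hx.1 hx'.1 ?_
  change dist x s = dist x' s
  rw [dist_comm x, dist_comm x']
  exact (hx.2 hsL x' hx'.1).antisymm (hx'.2 hsL x hx.1)

-- `nucleus` is defined by choice, so its measurability is not automatic. On the event `T1` that
-- there is exactly one nucleus, it lies in `B` exactly when one nucleus is counted in `B`; off `T1`
-- the measurable version is zero.
omit h in
lemma aemeasurable_nucleus {L : Set Plane} (hu : ∀ᵐ χ ∂Q, ∀ x x',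
    IsNucleusOfCellContaining L χ x → IsNucleusOfCellContaining L χ x' → x = x') :
    AEMeasurable (nucleus L) (Q.restrict {χ | ∃ x, IsNucleusOfCellContaining L χ x}) := by
  classical
  have hG := measurableSet_nucleusPairs L
  set T1 : Set PointConfig := {χ | countWithRest (nucleusPairs L) χ = 1}
  have hT1 : MeasurableSet T1 := measurable_countWithRest hG (measurableSet_singleton 1)
  have huT1 : ∀ χ ∈ T1, ∀ x x', IsNucleusOfCellContaining L χ x →
      IsNucleusOfCellContaining L χ x' → x = x' := by
    intro χ hχ x x' hx hx'
    exact Set.encard_le_one_iff.mp (le_of_eq hχ) x x' (isNucleus_iff_mem_nucleusPairs.mp hx)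
      (isNucleus_iff_mem_nucleusPairs.mp hx')
  have hexT1 : ∀ χ ∈ T1, ∃ x, IsNucleusOfCellContaining L χ x := by
    intro χ hχ
    obtain ⟨x, hx⟩ := Set.encard_eq_one.mp hχ
    have : x ∈ {x ∈ χ.points | (x, remove x χ) ∈ nucleusPairs L} := by rw [hx]; rfl
    exact ⟨x, isNucleus_iff_mem_nucleusPairs.mpr this⟩
  refine ⟨T1.piecewise (nucleus L) 0, fun B hB => ?_, ?_⟩
  · rw [Set.piecewise_preimage, Set.ite]
    refine MeasurableSet.union ?_ ((measurable_zero hB).diff hT1)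
    have hBm : MeasurableSet (nucleusPairs L ∩ Prod.fst ⁻¹' B) := hG.inter (measurable_fst hB)
    convert (measurable_countWithRest hBm (measurableSet_singleton 1)).inter hT1 using 1
    ext χ
    refine and_congr_left fun hχ => ?_
    rw [Set.mem_preimage, Set.mem_preimage, Set.mem_singleton_iff,
      countWithRest_of_unique (huT1 χ hχ)]
    simp [hexT1 χ hχ]
  · filter_upwards [ae_restrict_mem (measurableSet_exists_nucleus L),
      ae_restrict_of_ae hu] with χ hχ huχ
    rw [Set.piecewise_eq_of_mem]
    have := countWithRest_of_unique huχ Set.univ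
    rw [Set.inter_univ] at this
    change countWithRest _ _ = 1
    rw [this, if_pos ⟨hχ, trivial⟩]

lemma measure_nucleus_inter (hμ : ∀ B, Bornology.IsBounded B → μ B ≠ ∞) [SFinite μ]
    {L : Set Plane}
    (hu : ∀ᵐ χ ∂Q, ∀ x x', IsNucleusOfCellContaining L χ x →
      IsNucleusOfCellContaining L χ x' → x = x')
    {A : Set (Plane × PointConfig)} (hA : MeasurableSet A) :
    Q ({χ | ∃ x, IsNucleusOfCellContaining L χ x} ∩
      (fun χ => (nucleus L χ, remove (nucleus L χ) χ)) ⁻¹' A) =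
    ∫⁻ x, Q ({χ | count (openDoubledFlower x L) χ = 0} ∩ Prod.mk x ⁻¹' A) ∂μ := by
  classical
  have := h.isProbabilityMeasure
  have hGA := (measurableSet_nucleusPairs L).inter hA
  have hM : ∫⁻ x, Q ({χ | count (openDoubledFlower x L) χ = 0} ∩ Prod.mk x ⁻¹' A) ∂μ =
      ∫⁻ χ, (countWithRest (nucleusPairs L ∩ A) χ : ℝ≥0∞) ∂Q := by
    have := reducedCampbellMeasure_apply Q hGA
    rw [h.reducedCampbellMeasure_eq hμ, Measure.prod_apply hGA] at this
    exact this
  have hc1 : MeasurableSet {χ | countWithRest (nucleusPairs L ∩ A) χ = 1} :=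
    measurable_countWithRest hGA (measurableSet_singleton 1)
  rw [hM, measure_congr (t := {χ | countWithRest (nucleusPairs L ∩ A) χ = 1}),
    ← lintegral_indicator_one hc1]
  · refine lintegral_congr_ae ?_
    filter_upwards [hu] with χ hχ
    simp only [Set.indicator_apply, Set.mem_ofPred_eq, countWithRest_of_unique hχ]
    split_ifs <;> simp_all
  · rw [Filter.eventuallyEq_set]
    filter_upwards [hu] with χ hχ
    rw [countWithRest_of_unique hχ]
    simp

end

lemma smul_volume_ne_top (l : ℝ) {B : Set Plane} (hB : Bornology.IsBounded B) :
    (ENNReal.ofReal l • volume) B ≠ ∞ :=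
  ENNReal.mul_ne_top ENNReal.ofReal_ne_top hB.measure_lt_top.ne

lemma smul_volume_sphere (l : ℝ) (s : Plane) (r : ℝ) :
    (ENNReal.ofReal l • volume : Measure Plane) (Metric.sphere s r) = 0 := by
  rw [Measure.smul_apply, Measure.addHaar_sphere, smul_zero]

section
variable {l : ℝ} {Q : Measure PointConfig} (h : IsPoissonLaw (ENNReal.ofReal l • volume) Q)
include h

/-- The open and closed flowers differ by a null set, so their void events agree almost surely.
Conditioning on the closed one then factors the probability. -/
lemma measure_openDoubledFlower_void_inter (hl : 0 < l) {L : Set Plane} (hL : IsCompact L)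
    (x : Plane) [SFinite Q] {A : Set PointConfig} (hA : MeasurableSet A) :
    Q ({χ | count (openDoubledFlower x L) χ = 0} ∩ A) =
      nucleusWeight l L x * outsideFlowerKernel Q hL x A := by
  have hμ : ∀ B : Set Plane, Bornology.IsBounded B → (ENNReal.ofReal l • volume) B ≠ ∞ :=
    fun B hB => smul_volume_ne_top l hB
  have hDm := measurableSet_doubledFlower x hL
  have hDb := isBounded_doubledFlower x hL
  have hUm := measurableSet_openDoubledFlower x L
  rw [outsideFlowerKernel_apply, Measure.map_apply (measurable_sdiff hDm) hA,
    nucleusWeight_eq hl, ← h.measure_void hDm (hμ _ hDb), ← h.measure_void_inter hμ hDm hDb hA]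
  refine measure_congr ?_
  have hnull := h.measure_count_ne_zero (hDm.diff hUm)
    (by rw [Measure.smul_apply, volume_doubledFlower_sdiff x hL, smul_zero])
  refine Filter.EventuallyEq.inter (Filter.eventuallyEq_set.mpr ?_) (.refl _ _)
  filter_upwards [compl_mem_ae_iff.mpr hnull] with χ hχ
  have hχ' : count (doubledFlower x L \ openDoubledFlower x L) χ = 0 := not_not.mp hχ
  have hD := count_union_eq_zero (B := openDoubledFlower x L)
    (C := doubledFlower x L \ openDoubledFlower x L) (χ := χ)
  rw [Set.union_sdiff_cancel (openDoubledFlower_subset x L)] at hD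
  rw [hD]
  exact (and_iff_left hχ').symm

lemma measure_nucleus_inter_eq (hl : 0 < l) {L : Set Plane} (hL : IsCompact L)
    (hne : L.Nonempty) [SFinite Q] {A : Set (Plane × PointConfig)} (hA : MeasurableSet A) :
    Q ({χ | ∃ x, IsNucleusOfCellContaining L χ x} ∩
      (fun χ => (nucleus L χ, remove (nucleus L χ) χ)) ⁻¹' A) =
    ENNReal.ofReal l * ∫⁻ x, nucleusWeight l L x *
      outsideFlowerKernel Q hL x (Prod.mk x ⁻¹' A) := by
  have hμ : ∀ B : Set Plane, Bornology.IsBounded B → (ENNReal.ofReal l • volume) B ≠ ∞ :=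
    fun B hB => smul_volume_ne_top l hB
  rw [h.measure_nucleus_inter hμ (h.ae_nucleus_unique hμ (smul_volume_sphere l) hne) hA,
    lintegral_smul_measure, smul_eq_mul]
  simp_rw [h.measure_openDoubledFlower_void_inter hl hL _ (measurable_prodMk_left hA)]

lemma measure_exists_nucleus (hl : 0 < l) {L : Set Plane} (hL : IsCompact L)
    (hne : L.Nonempty) :
    Q {χ | ∃ x, IsNucleusOfCellContaining L χ x} =
      ENNReal.ofReal l * ∫⁻ x, nucleusWeight l L x := by
  have := h.isProbabilityMeasure
  have e := h.measure_nucleus_inter_eq hl hL hne MeasurableSet.univ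
  simpa using e

/-- No estimate of the flower is needed: `l` times the integral is a probability. -/
lemma lintegral_nucleusWeight_ne_top (hl : 0 < l) {L : Set Plane} (hL : IsCompact L)
    (hne : L.Nonempty) : ∫⁻ x, nucleusWeight l L x ≠ ∞ := by
  have := h.isProbabilityMeasure
  intro htop
  have e := h.measure_exists_nucleus hl hL hne
  rw [htop, ENNReal.mul_top (ENNReal.ofReal_pos.mpr hl).ne'] at e
  exact measure_ne_top Q _ e

/-- The joint law of the nucleus and of the other points, given that there is a nucleus. -/
lemma map_cond_nucleus (hl : 0 < l) {L : Set Plane} (hL : IsCompact L)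
    (hne : L.Nonempty) [IsProbabilityMeasure Q] :
    AEMeasurable (fun χ => (nucleus L χ, remove (nucleus L χ) χ))
      (Q[|{χ | ∃ x, IsNucleusOfCellContaining L χ x}]) ∧
    (Q[|{χ | ∃ x, IsNucleusOfCellContaining L χ x}]).map
      (fun χ => (nucleus L χ, remove (nucleus L χ) χ)) =
        nucleusLaw l L ⊗ₘ outsideFlowerKernel Q hL := by
  have hT := measurableSet_exists_nucleus L
  have hJ : AEMeasurable (fun χ => (nucleus L χ, remove (nucleus L χ) χ))
      (Q[|{χ | ∃ x, IsNucleusOfCellContaining L χ x}]) := by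
    have hn := (aemeasurable_nucleus (h.ae_nucleus_unique
      (fun B hB => smul_volume_ne_top l hB) (smul_volume_sphere l) hne)).smul_measure
        (Q {χ | ∃ x, IsNucleusOfCellContaining L χ x})⁻¹
    exact hn.prodMk (measurable_remove.comp_aemeasurable (hn.prodMk aemeasurable_id))
  refine ⟨hJ, Measure.ext fun A hA => ?_⟩
  have hlpos : ENNReal.ofReal l ≠ 0 := (ENNReal.ofReal_pos.mpr hl).ne'
  rw [Measure.map_apply_of_aemeasurable hJ hA, cond_apply hT, h.measure_exists_nucleus hl hL hne,
    h.measure_nucleus_inter_eq hl hL hne hA, nucleusLaw, Measure.compProd_apply hA,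
    lintegral_smul_measure, lintegral_withDensity_eq_lintegral_mul _
      (measurable_nucleusWeight l hL) (Kernel.measurable_kernel_prodMk_left hA),
    ENNReal.mul_inv (.inl hlpos) (.inl ENNReal.ofReal_ne_top), smul_eq_mul]
  simp only [Pi.mul_apply]
  rw [mul_comm (ENNReal.ofReal l)⁻¹, mul_assoc, ← mul_assoc (ENNReal.ofReal l)⁻¹,
    ENNReal.inv_mul_cancel hlpos ENNReal.ofReal_ne_top, one_mul]

end
end IsPoissonLaw

/-! ### Transfer to the underlying probability space -/

namespace PointConfig

lemma add_remove {x : Plane} {χ : PointConfig} (hx : x ∈ χ.points) : (remove x χ).add x = χ := by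
  refine ext_points ?_
  rw [points_add, points_remove]
  exact Set.union_sdiff_cancel (Set.singleton_subset_iff.mpr hx)

end PointConfig

lemma map_cond_preimage {Ω E : Type*} [MeasurableSpace Ω] [MeasurableSpace E] {P : Measure Ω}
    {η : Ω → E} (hη : Measurable η) {T : Set E} (hT : MeasurableSet T) :
    (P[|η ⁻¹' T]).map η = (P.map η)[|T] := by
  ext A hA
  rw [Measure.map_apply hη hA, cond_apply (hη hT), cond_apply hT, Measure.map_apply hη hT,
    Measure.map_apply hη (hT.inter hA), Set.preimage_inter]

theorem mainTheorem11 {Ω : Type*} [MeasurableSpace Ω] (P : Measure Ω) [IsProbabilityMeasure P]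
    (K : ConvexBody Plane) (l : ℝ) (hl : 0 < l)
    (η : Ω → PointConfig) (hη : Measurable η)
    (hPoisson : IsPoissonLaw (ENNReal.ofReal l • volume) (P.map η))
    (S : Set Ω) (hS : S = {ω | ∃ x, IsNucleusOfCellContaining (K : Set Plane) (η ω) x}) :
    -- conditioning on `S` is meaningful, and on `S` the nucleus is almost surely unique
    MeasurableSet S ∧ P S ≠ 0 ∧
    (∀ᵐ ω ∂P, ω ∈ S → ∃! x, IsNucleusOfCellContaining (K : Set Plane) (η ω) x) ∧
    -- the density of the nucleus can be normalized
    (∫⁻ x, nucleusWeight l K x) ≠ 0 ∧ (∫⁻ x, nucleusWeight l K x) ≠ ∞ ∧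
    ∃ κ : Kernel Plane PointConfig,
      (∀ x, IsPoissonLaw ((ENNReal.ofReal l • volume).restrict (doubledFlower x K)ᶜ) (κ x)) ∧
      -- conditional joint law of the nucleus and of the other points
      (P[|S]).map (fun ω => (nucleus K (η ω), (η ω).remove (nucleus K (η ω)))) =
        nucleusLaw l K ⊗ₘ κ ∧
      -- conditional law of the whole process
      (P[|S]).map η =
        (nucleusLaw l K ⊗ₘ κ).map (fun p : Plane × PointConfig => p.2.add p.1) := by
  have hS' : S = η ⁻¹' {χ | ∃ x, IsNucleusOfCellContaining (K : Set Plane) χ x} := hS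
  have hT := PointConfig.measurableSet_exists_nucleus (K : Set Plane)
  have := hPoisson.isProbabilityMeasure
  have hw := lintegral_nucleusWeight_ne_zero l K.isCompact
  have hPS : P S = ENNReal.ofReal l * ∫⁻ x, nucleusWeight l K x := by
    rw [← hPoisson.measure_exists_nucleus hl K.isCompact K.nonempty, hS', Measure.map_apply hη hT]
  have hPS0 : P S ≠ 0 := by
    rw [hPS]
    exact mul_ne_zero (ENNReal.ofReal_pos.mpr hl).ne' hw
  obtain ⟨hJ, hmap⟩ := hPoisson.map_cond_nucleus hl K.isCompact K.nonempty
  rw [← map_cond_preimage hη hT, ← hS'] at hJ hmap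
  have hmap' : (P[|S]).map (fun ω => (nucleus K (η ω), (η ω).remove (nucleus K (η ω)))) =
      nucleusLaw l K ⊗ₘ PointConfig.outsideFlowerKernel (P.map η) K.isCompact := by
    rw [← hmap, AEMeasurable.map_map_of_aemeasurable hJ hη.aemeasurable]
    rfl
  refine ⟨hS' ▸ hη hT, hPS0, ?_, hw,
    hPoisson.lintegral_nucleusWeight_ne_top hl K.isCompact K.nonempty,
    PointConfig.outsideFlowerKernel (P.map η) K.isCompact, fun x => ?_, hmap', ?_⟩
  · have hu := hPoisson.ae_nucleus_unique (fun B hB => IsPoissonLaw.smul_volume_ne_top l hB)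
      (IsPoissonLaw.smul_volume_sphere l) K.nonempty
    filter_upwards [ae_of_ae_map hη.aemeasurable hu] with ω hω hωS
    rw [hS] at hωS
    obtain ⟨x, hx⟩ := hωS
    exact ⟨x, hx, fun y hy => hω y x hy hx⟩
  · exact hPoisson.map_sdiff (measurableSet_doubledFlower x K.isCompact)
  · have hadd : Measurable fun p : Plane × PointConfig => p.2.add p.1 := PointConfig.measurable_add
    have hJη : AEMeasurable
        (fun ω => (nucleus K (η ω), (η ω).remove (nucleus K (η ω)))) (P[|S]) :=
      hJ.comp_measurable hη
    -- On `S` the nucleus is a point of the configuration, so removing it and adding it back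
    -- recovers the process.
    rw [← hmap', AEMeasurable.map_map_of_aemeasurable hadd.aemeasurable hJη]
    refine Measure.map_congr ?_
    filter_upwards [ae_cond_mem (hS' ▸ hη hT)] with ω hω
    rw [hS] at hω
    exact (PointConfig.add_remove (PointConfig.isNucleus_nucleus hω).1).symm
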